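/- Let $a\ge 2$ and $C\ge 0$ be integers. There is $n_0=n_0(a,C)$ such that the following holds for every $n\ge n_0$. Let $G$ be a graph on $2n$ vertices which contains $K_{n,n}-H$ as a (spanning) subgraph, for some copy of $K_{n,n}$ on the vertex set of $G$ and some graph $H$ on the same vertex set with at most $C$ edges. Consider the $(a:a)$ Maker-Breaker game played on the edge set of $G$: in each round first Breaker and then Maker claims exactly $a$ edges of $G$ that have not been claimed before (all the remaining unclaimed edges, if there are fewer than $a$). Then Maker has a strategy which, however Breaker plays, ensures that within at most $\lfloor n/a\rfloor+1$ rounds she has claimed all the edges of a perfect matching of $G$. If $G=K_{2n}$, then she has such a strategy which does so within at most $\lceil n/a\rceil$ rounds. -/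

import Mathlib

namespace MakerBreaker

variable {α : Type*} [DecidableEq α]

/-- A legal move of a player with bias `p` on the board `X`, when the elements of `claimed` have
already been claimed: the player claims exactly `p` free elements (all of the free elements, if
there are fewer than `p` of them). -/
def IsMove (X claimed : Finset α) (p : ℕ) (S : Finset α) : Prop :=
  S ⊆ X \ claimed ∧ S.card = min p (X \ claimed).card

/-- A strategy of Maker, when Breaker moves first: given the list of the moves that Breaker has
made so far (in the order in which they were made), it returns Maker's next move. -/
abbrev Strategy (α : Type*) := List (Finset α) → Finset α

/-- Maker's move in round `i` (rounds are numbered from `0`), if she follows `σ` and the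
moves of Breaker are `β 0, β 1, …`. -/
def makerMove (σ : Strategy α) (β : ℕ → Finset α) (i : ℕ) : Finset α :=
  σ ((List.range (i + 1)).map β)

/-- The set of elements claimed by Maker in the first `k` rounds. -/
def makerSet (σ : Strategy α) (β : ℕ → Finset α) (k : ℕ) : Finset α :=
  (Finset.range k).biUnion (makerMove σ β)

/-- The set of elements claimed by Breaker in the first `k` rounds. -/
def breakerSet (β : ℕ → Finset α) (k : ℕ) : Finset α :=
  (Finset.range k).biUnion β

/-- In the `(a : b)` Maker-Breaker game with board `X` and family of winning sets `F`, in which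
each round consists of a move of Breaker (bias `b`) followed by a move of Maker (bias `a`), Maker
has a strategy to fully claim a winning set within at most `k` rounds. -/
def MakerWinsWithin (X : Finset α) (F : Set (Finset α)) (a b k : ℕ) : Prop :=
  ∃ σ : Strategy α, ∀ β : ℕ → Finset α,
    -- if all the moves of Breaker are legal, then
    (∀ i < k, IsMove X (makerSet σ β i ∪ breakerSet β i) b (β i)) →
      -- all the moves of Maker are legal, and
      (∀ i < k, IsMove X (makerSet σ β i ∪ breakerSet β (i + 1)) a (makerMove σ β i)) ∧
      -- after `k` rounds she owns all the elements of some winning set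
      ∃ W ∈ F, W ⊆ makerSet σ β k

end MakerBreaker

/-- The edge sets of the perfect matchings of `G`. -/
def SimpleGraph.perfectMatchingSets {V : Type*} (G : SimpleGraph V) : Set (Finset (Sym2 V)) :=
  {W | ∃ P : G.Subgraph, P.IsPerfectMatching ∧ (W : Set (Sym2 V)) = P.edgeSet}

/-! Call a pair of the bipartition bad if it is missing from the start or claimed by Breaker. Maker
enlarges a matching by `a` edges per typical round, always choosing edges that are not bad and whose
ends meet two bad pairs among the uncovered vertices, if so many remain (`exists_good_pair`).
Breaker creates at most `a` bad pairs per round and Maker removes up to `2 * a`, so the initial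
defect dies out and afterwards no bad pair lies among the uncovered vertices when Breaker moves.

The danger is the end: with exactly `a` pairs left, Breaker could block every partner of one vertex.
The rounds are therefore scheduled so that only `r < a` pairs are left for the final one. The `a -
r` spare edges pay for exchanges (`PartialMatching.exchange`): uncovered `x`, `y` are covered by
replacing a matched pair `(p, σ p)` with `(x, σ p)` and `(p, y)`. A suitable `p` exists if the bad
pairs touching uncovered vertices are fewer than the covered pairs, and this is what the potential
in `winsFrom_of_partialMatching` guarantees. `PartialMatching.complete_of_spare` shows that the
spare edges suffice.

In the complete graph no spare round is needed: isolating a vertex among `2 * a` uncovered ones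
takes `2 * a - 1 > a` edges, so Maker can restore, after each round, the property that Breaker has
no edge between uncovered vertices (`winsFrom_top`). -/

namespace MakerBreaker

/-! ### Winning positions by backward induction, and strategies -/

section Game

variable {α : Type*} [DecidableEq α]

/-- Maker can fully claim a member of `F` within `k` further rounds, when she owns `M` and
Breaker owns `B`. -/
def WinsFrom (X : Finset α) (F : Set (Finset α)) (a b : ℕ) : ℕ → Finset α → Finset α → Prop
  | 0, M, _ => ∃ W ∈ F, W ⊆ M
  | k + 1, M, B => ∀ S, IsMove X (M ∪ B) b S →
      ∃ T, IsMove X (M ∪ (B ∪ S)) a T ∧ WinsFrom X F a b k (M ∪ T) (B ∪ S)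

open Classical in
/-- A move of Maker, in answer to the move `S` of Breaker, that keeps the position
`(k, M, B)` won. -/
noncomputable def answer (X : Finset α) (F : Set (Finset α)) (a b : ℕ)
    (s : ℕ × Finset α × Finset α) (S : Finset α) : Finset α :=
  if h : ∃ T, IsMove X (s.2.1 ∪ (s.2.2 ∪ S)) a T ∧
      WinsFrom X F a b (s.1 - 1) (s.2.1 ∪ T) (s.2.2 ∪ S) then h.choose else ∅

/-- The position after the move `S` of Breaker and Maker's `answer`. -/
noncomputable def nextPosition (X : Finset α) (F : Set (Finset α)) (a b : ℕ)
    (s : ℕ × Finset α × Finset α) (S : Finset α) : ℕ × Finset α × Finset α :=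
  (s.1 - 1, s.2.1 ∪ answer X F a b s S, s.2.2 ∪ S)

theorem answer_spec {X : Finset α} {F : Set (Finset α)} {a b k : ℕ} {M B S : Finset α}
    (h : WinsFrom X F a b (k + 1) M B) (hS : IsMove X (M ∪ B) b S) :
    IsMove X (M ∪ (B ∪ S)) a (answer X F a b (k + 1, M, B) S) ∧
      WinsFrom X F a b k (M ∪ answer X F a b (k + 1, M, B) S) (B ∪ S) := by
  have h' : ∃ T, IsMove X (M ∪ (B ∪ S)) a T ∧
      WinsFrom X F a b (k + 1 - 1) (M ∪ T) (B ∪ S) := h S hS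
  unfold answer
  rw [dif_pos h']
  exact h'.choose_spec

/-- A strategy sees only Breaker's moves, but Maker's own earlier answers are determined by them:
folding `nextPosition` over all moves but the last recovers the position to be answered. -/
theorem makerWinsWithin_of_winsFrom {X : Finset α} {F : Set (Finset α)} {a b k : ℕ}
    (h : WinsFrom X F a b k ∅ ∅) : MakerWinsWithin X F a b k := by
  let σ : Strategy α := fun l =>
    answer X F a b (l.dropLast.foldl (nextPosition X F a b) (k, ∅, ∅)) (l.getLast?.getD ∅)
  refine ⟨σ, fun β hβ => ?_⟩
  have hσ : ∀ i, makerMove σ β i = answer X F a b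
      (((List.range i).map β).foldl (nextPosition X F a b) (k, ∅, ∅)) (β i) := by
    intro i
    simp [makerMove, σ, List.range_succ]
  have hM : ∀ i, makerSet σ β (i + 1) = makerSet σ β i ∪ makerMove σ β i := by
    intro i
    simp [makerSet, Finset.range_add_one, Finset.union_comm]
  have hB : ∀ i, breakerSet β (i + 1) = breakerSet β i ∪ β i := by
    intro i
    simp [breakerSet, Finset.range_add_one, Finset.union_comm]
  have hpos : ∀ i, ((List.range i).map β).foldl (nextPosition X F a b) (k, ∅, ∅) =
      (k - i, makerSet σ β i, breakerSet β i) := by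
    intro i
    induction i with
    | zero => simp [makerSet, breakerSet]
    | succ i ih =>
      rw [hM, hB, hσ, ih, List.range_succ, List.map_append, List.foldl_append, ih]
      simp [nextPosition, Nat.sub_sub]
  have key : ∀ i ≤ k, WinsFrom X F a b (k - i) (makerSet σ β i) (breakerSet β i) ∧
      ∀ i' < i, IsMove X (makerSet σ β i' ∪ breakerSet β (i' + 1)) a (makerMove σ β i') := by
    intro i
    induction i with
    | zero => intro _; exact ⟨by simpa [makerSet, breakerSet] using h, by simp⟩
    | succ i ih =>
      intro hi
      obtain ⟨h1, h2⟩ := ih (by omega)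
      obtain ⟨d, hd⟩ : ∃ d, k - i = d + 1 := ⟨k - i - 1, by omega⟩
      rw [hd] at h1
      have h3 := answer_spec h1 (hβ i (by omega))
      have h4 : makerMove σ β i =
          answer X F a b (d + 1, makerSet σ β i, breakerSet β i) (β i) := by
        rw [hσ, hpos, hd]
      rw [← h4, ← hM, ← hB] at h3
      refine ⟨by rw [show k - (i + 1) = d by omega]; exact h3.2, fun i' hi' => ?_⟩
      rcases Nat.lt_succ_iff_lt_or_eq.1 hi' with h5 | rfl
      · exact h2 i' h5
      · exact h3.1
  obtain ⟨h1, h2⟩ := key k le_rfl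
  refine ⟨h2, ?_⟩
  simpa [WinsFrom] using h1

/-- Maker can claim any `a` elements that Breaker has not claimed. -/
theorem exists_isMove {X M B T₀ : Finset α} {a : ℕ} (hX : T₀ ⊆ X) (hB : Disjoint T₀ B)
    (ha : T₀.card ≤ a) : ∃ T, IsMove X (M ∪ B) a T ∧ T₀ ⊆ M ∪ T := by
  have h1 : T₀ \ M ⊆ X \ (M ∪ B) := by
    intro x hx
    have := Finset.disjoint_left.1 hB (Finset.mem_sdiff.1 hx).1
    have := hX (Finset.mem_sdiff.1 hx).1
    simp_all
  have h2 : (T₀ \ M).card ≤ a := (Finset.card_le_card Finset.sdiff_subset).trans ha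
  -- A legal move has a prescribed size, so the wanted elements are padded with arbitrary free ones.
  obtain ⟨T, hT1, hT2, hT3⟩ := Finset.exists_subsuperset_card_eq h1
    (le_min h2 (Finset.card_le_card h1)) (min_le_right a _)
  refine ⟨T, ⟨hT2, hT3⟩, fun x hx => ?_⟩
  by_cases hxM : x ∈ M
  · exact Finset.mem_union_left _ hxM
  · exact Finset.mem_union_right _ (hT1 (Finset.mem_sdiff.2 ⟨hx, hxM⟩))

end Game

/-! ### Partial matchings and exchanges in a bipartite graph -/

section Bipartite

variable {ι : Type*}

/-- There is a perfect matching between the complements of `U` and `V` whose pairs satisfy `Own`,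
except for at most `c` of them, which avoid `bad`. -/
def PartialMatching (Own : ι × ι → Prop) (bad : Finset (ι × ι)) (c : ℕ) (U V : Finset ι) : Prop :=
  ∃ (σ : Equiv.Perm ι) (E : Finset (ι × ι)), (∀ i, i ∈ U ↔ σ i ∈ V) ∧ E.card ≤ c ∧
    Disjoint E bad ∧ ∀ i ∉ U, Own (i, σ i) ∨ (i, σ i) ∈ E

variable {Own : ι × ι → Prop} {bad : Finset (ι × ι)} {c : ℕ} {U V : Finset ι} {x y : ι}

theorem PartialMatching.mono {c' : ℕ} (h : PartialMatching Own bad c U V) (hc : c ≤ c') :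
    PartialMatching Own bad c' U V := by
  obtain ⟨σ, E, h1, h2, h3⟩ := h
  exact ⟨σ, E, h1, h2.trans hc, h3⟩

variable [DecidableEq ι]

/-- The members of `bad` that lie inside `U × V`. -/
def inner (bad : Finset (ι × ι)) (U V : Finset ι) : Finset (ι × ι) :=
  bad.filter fun p => p.1 ∈ U ∧ p.2 ∈ V

/-- The members of `bad` with at least one end in `U` or `V`. -/
def touching (bad : Finset (ι × ι)) (U V : Finset ι) : Finset (ι × ι) :=
  bad.filter fun p => p.1 ∈ U ∨ p.2 ∈ V

theorem mem_inner {p : ι × ι} : p ∈ inner bad U V ↔ p ∈ bad ∧ p.1 ∈ U ∧ p.2 ∈ V := by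
  simp [inner]

theorem PartialMatching.extend (h : PartialMatching Own bad c U V) (hx : x ∈ U) (hy : y ∈ V)
    (hxy : (x, y) ∉ bad) : PartialMatching Own bad (c + 1) (U.erase x) (V.erase y) := by
  obtain ⟨σ, E, h1, h2, h3, h4⟩ := h
  have hy' : σ.symm y ∈ U := by rw [h1]; simpa using hy
  refine ⟨σ * Equiv.swap x (σ.symm y), insert (x, y) E, fun i => ?_,
    (Finset.card_insert_le _ _).trans (by omega), ?_, fun i hi => ?_⟩
  · rw [Equiv.Perm.mul_apply, Equiv.swap_apply_def]
    have h5 := h1 x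
    have h6 := h1 i
    have h7 : ∀ j, σ j = y ↔ j = σ.symm y := fun j => by rw [Equiv.eq_symm_apply]
    split_ifs with h8 h9
    · simp [h8]
    · have : σ x ≠ y := by rw [Ne, h7]; rintro rfl; exact h8 h9
      simp_all
    · simp [h7, h8, h9, h6]
  · rw [Finset.disjoint_insert_left]
    exact ⟨hxy, h3⟩
  · rw [Equiv.Perm.mul_apply, Equiv.swap_apply_def]
    by_cases h5 : i = x
    · simp [h5]
    · have h6 : i ∉ U := fun h => hi (Finset.mem_erase.2 ⟨h5, h⟩)
      rw [if_neg h5, if_neg (by rintro rfl; exact h6 hy')]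
      exact (h4 i h6).imp_right fun h => Finset.mem_insert_of_mem h

/-- A pair of uncovered vertices can be covered at the cost of two new pairs, by an exchange with
a pair of the matching. -/
theorem PartialMatching.exchange [Fintype ι] (h : PartialMatching Own bad c U V)
    (hx : x ∈ U) (hy : y ∈ V)
    (hP : (touching bad U V).card + U.card < Fintype.card ι) :
    PartialMatching Own bad (c + 2) (U.erase x) (V.erase y) := by
  obtain ⟨σ, E, h1, h2, h3, h4⟩ := h
  have hy' : σ.symm y ∈ U := by rw [h1]; simpa using hy
  obtain ⟨p, hpU, hp1, hp2⟩ : ∃ p, p ∉ U ∧ (x, σ p) ∉ bad ∧ (p, y) ∉ bad := by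
    by_contra! hcon
    -- If no `p` works, each covered `p` yields a bad pair touching `x` or `y`. These are distinct:
    -- those at `x` have first entry in `U`, those at `y` do not.
    have h5 : Uᶜ.card ≤ (touching bad U V).card := by
      refine Finset.card_le_card_of_injOn
        (fun p => if (x, σ p) ∈ bad then (x, σ p) else (p, y)) ?_ ?_
      · intro p hp
        have hp' : p ∉ U := by simpa using hp
        have := hcon p hp'
        simp only [touching, Finset.coe_filter, Set.mem_ofPred_eq]
        split_ifs with h6
        · exact ⟨h6, Or.inl hx⟩
        · exact ⟨this h6, Or.inr hy⟩
      · intro p hp p' hp' hpp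
        have hp1 : p ∉ U := by simpa using hp
        have hp2 : p' ∉ U := by simpa using hp'
        simp only at hpp
        split_ifs at hpp with h6 h7 h7
        · simpa using hpp
        · obtain ⟨rfl, _⟩ := Prod.mk.inj hpp; exact absurd hx hp2
        · obtain ⟨rfl, _⟩ := Prod.mk.inj hpp; exact absurd hx hp1
        · exact (Prod.ext_iff.1 hpp).1
    rw [Finset.card_compl] at h5
    omega
  have hxp : x ≠ p := by rintro rfl; exact hpU hx
  have hyp : σ.symm y ≠ p := by rintro h; exact hpU (h ▸ hy')
  -- This permutation sends `x` to `σ p`, `p` to `y` and, if `σ x ≠ y`, `σ.symm y` to `σ x`.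
  refine ⟨σ * Equiv.swap x (σ.symm y) * Equiv.swap x p, insert (x, σ p) (insert (p, y) E),
    fun i => ?_, (Finset.card_insert_le _ _).trans
      (by have := Finset.card_insert_le (p, y) E; omega), ?_, fun i hi => ?_⟩
  · have h7 : ∀ j, σ j = y ↔ j = σ.symm y := fun j => by rw [Equiv.eq_symm_apply]
    rw [Equiv.Perm.mul_apply, Equiv.Perm.mul_apply]
    by_cases hix : i = x
    · subst hix
      rw [Equiv.swap_apply_left, Equiv.swap_apply_of_ne_of_ne hxp.symm hyp.symm]
      simp [← h1, hpU]
    by_cases hip : i = p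
    · subst hip
      rw [Equiv.swap_apply_right, Equiv.swap_apply_left]
      simp [hpU]
    rw [Equiv.swap_apply_of_ne_of_ne hix hip]
    by_cases hiy : i = σ.symm y
    · subst hiy
      rw [Equiv.swap_apply_right]
      have h8 : σ x ≠ y := by rw [Ne, h7]; exact fun h => hix h.symm
      simp [hix, hy', h8, ← h1, hx]
    · rw [Equiv.swap_apply_of_ne_of_ne hix hiy]
      simp [hix, h7, hiy, h1]
  · rw [Finset.disjoint_insert_left, Finset.disjoint_insert_left]
    exact ⟨hp1, hp2, h3⟩
  · rw [Equiv.Perm.mul_apply, Equiv.Perm.mul_apply]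
    by_cases hix : i = x
    · subst hix
      rw [Equiv.swap_apply_left, Equiv.swap_apply_of_ne_of_ne hxp.symm hyp.symm]
      simp
    by_cases hip : i = p
    · subst hip
      rw [Equiv.swap_apply_right, Equiv.swap_apply_left]
      simp
    have hiU : i ∉ U := fun h => hi (Finset.mem_erase.2 ⟨hix, h⟩)
    have hiy : i ≠ σ.symm y := by rintro rfl; exact hiU hy'
    rw [Equiv.swap_apply_of_ne_of_ne hix hip, Equiv.swap_apply_of_ne_of_ne hix hiy]
    exact (h4 i hiU).imp_right fun h =>
      Finset.mem_insert_of_mem (Finset.mem_insert_of_mem h)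

/-! ### Bad pairs removed by covering one pair -/

theorem mem_touching {p : ι × ι} : p ∈ touching bad U V ↔ p ∈ bad ∧ (p.1 ∈ U ∨ p.2 ∈ V) := by
  simp [touching]

theorem inner_erase_subset : inner bad (U.erase x) (V.erase y) ⊆ inner bad U V := by
  intro p
  simp only [mem_inner, Finset.mem_erase]
  tauto

theorem card_touching_erase_le :
    (touching bad (U.erase x) (V.erase y)).card ≤ (touching bad U V).card := by
  refine Finset.card_le_card fun p => ?_
  simp only [mem_touching, Finset.mem_erase]
  tauto

theorem card_inner_erase_add_le {D : Finset (ι × ι)} (hD : D ⊆ inner bad U V)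
    (h : ∀ p ∈ D, p.1 = x ∨ p.2 = y) :
    (inner bad (U.erase x) (V.erase y)).card + D.card ≤ (inner bad U V).card := by
  rw [← Finset.card_union_of_disjoint]
  · exact Finset.card_le_card (Finset.union_subset inner_erase_subset hD)
  · rw [Finset.disjoint_left]
    intro p hp hpD
    have := h p hpD
    simp only [mem_inner, Finset.mem_erase] at hp
    tauto

theorem card_inner_erase_lt {p : ι × ι} (hp : p ∈ inner bad U V) (h : p.1 = x ∨ p.2 = y) :
    (inner bad (U.erase x) (V.erase y)).card + 1 ≤ (inner bad U V).card := by
  simpa using card_inner_erase_add_le (D := {p}) (by simpa using hp) (by simpa using h)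

theorem card_inner_erase_add_two_le {p q : ι × ι} (hp : p ∈ inner bad U V)
    (hq : q ∈ inner bad U V) (hpq : p ≠ q) (h : p.1 = x ∨ p.2 = y) (h' : q.1 = x ∨ q.2 = y) :
    (inner bad (U.erase x) (V.erase y)).card + 2 ≤ (inner bad U V).card := by
  have := card_inner_erase_add_le (bad := bad) (U := U) (V := V) (D := {p, q}) (x := x) (y := y)
    (by simp [Finset.insert_subset_iff, hp, hq]) (by simp [h, h'])
  rwa [Finset.card_pair hpq] at this

/-- Any vertices can be chosen so that covering them removes two inner bad pairs. -/
theorem exists_card_inner_erase_le (hU : U.Nonempty) (hV : V.Nonempty) :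
    ∃ x ∈ U, ∃ y ∈ V,
      (inner bad (U.erase x) (V.erase y)).card ≤ (inner bad U V).card - 2 := by
  rcases (inner bad U V).eq_empty_or_nonempty with h0 | ⟨p, hp⟩
  · obtain ⟨x, hx⟩ := hU
    obtain ⟨y, hy⟩ := hV
    refine ⟨x, hx, y, hy, ?_⟩
    have := Finset.card_le_card (inner_erase_subset (bad := bad) (U := U) (V := V) (x := x) (y := y))
    rw [h0] at this ⊢
    simpa using this
  · obtain ⟨hp1, hpU, hpV⟩ := mem_inner.1 hp
    by_cases h : ∃ q ∈ inner bad U V, q ≠ p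
    · obtain ⟨q, hq, hqp⟩ := h
      obtain ⟨hq1, hqU, hqV⟩ := mem_inner.1 hq
      refine ⟨p.1, hpU, q.2, hqV, ?_⟩
      have := card_inner_erase_add_two_le hp hq hqp.symm (x := p.1) (y := q.2) (by simp) (by simp)
      omega
    · push Not at h
      refine ⟨p.1, hpU, p.2, hpV, ?_⟩
      have h1 := card_inner_erase_lt hp (x := p.1) (y := p.2) (by simp)
      have h2 : (inner bad U V).card ≤ 1 :=
        Finset.card_le_one.2 fun q hq q' hq' => (h q hq).trans (h q' hq').symm
      omega

/-- If no uncovered vertex sees only bad pairs, then a pair that is not bad can be chosen so that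
covering it removes two inner bad pairs. -/
theorem exists_notMem_card_inner_erase_le (hne : (inner bad U V).Nonempty)
    (hU : ∀ x ∈ U, ∃ y ∈ V, (x, y) ∉ bad) (hV : ∀ y ∈ V, ∃ x ∈ U, (x, y) ∉ bad) :
    ∃ x ∈ U, ∃ y ∈ V, (x, y) ∉ bad ∧
      (inner bad (U.erase x) (V.erase y)).card ≤ (inner bad U V).card - 2 := by
  obtain ⟨p, hp⟩ := hne
  obtain ⟨hp1, hpU, hpV⟩ := mem_inner.1 hp
  by_cases h : ∃ q ∈ inner bad U V, q ≠ p
  · obtain ⟨q, hq, hqp⟩ := h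
    obtain ⟨hq1, hqU, hqV⟩ := mem_inner.1 hq
    by_cases h1 : q.1 = p.1
    · obtain ⟨y, hy, hxy⟩ := hU p.1 hpU
      refine ⟨p.1, hpU, y, hy, hxy, ?_⟩
      have := card_inner_erase_add_two_le hp hq hqp.symm (x := p.1) (y := y) (by simp) (by simp [h1])
      omega
    -- The natural choice `(p.1, q.2)` meets both `p` and `q`. If it is bad, then either the row of
    -- `p` or the column of `q` contains two bad pairs, and covering that vertex by any good pair is
    -- enough.
    by_cases h2 : (p.1, q.2) ∈ bad
    · obtain ⟨y, hy, hxy⟩ := hU p.1 hpU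
      by_cases h3 : (p.1, q.2) = p
      · obtain ⟨x, hx, hxy⟩ := hV q.2 hqV
        refine ⟨x, hx, q.2, hqV, hxy, ?_⟩
        have := card_inner_erase_add_two_le hp hq hqp.symm (x := x) (y := q.2)
          (by rw [← h3]; simp) (by simp)
        omega
      · refine ⟨p.1, hpU, y, hy, hxy, ?_⟩
        have := card_inner_erase_add_two_le hp (mem_inner.2 ⟨h2, hpU, hqV⟩) (Ne.symm h3)
          (x := p.1) (y := y) (by simp) (by simp)
        omega
    · refine ⟨p.1, hpU, q.2, hqV, h2, ?_⟩
      have := card_inner_erase_add_two_le hp hq hqp.symm (x := p.1) (y := q.2) (by simp) (by simp)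
      omega
  · push Not at h
    obtain ⟨y, hy, hxy⟩ := hU p.1 hpU
    refine ⟨p.1, hpU, y, hy, hxy, ?_⟩
    have h1 := card_inner_erase_lt hp (x := p.1) (y := y) (by simp)
    have h2 : (inner bad U V).card ≤ 1 :=
      Finset.card_le_one.2 fun q hq q' hq' => (h q hq).trans (h q' hq').symm
    omega

theorem image_right_subset_inner (hx : x ∈ U) (h : ∀ y ∈ V, (x, y) ∈ bad) :
    V.image (fun y => (x, y)) ⊆ inner bad U V := by
  intro p hp
  obtain ⟨y, hy, rfl⟩ := Finset.mem_image.1 hp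
  exact mem_inner.2 ⟨h y hy, hx, hy⟩

theorem image_left_subset_inner (hy : y ∈ V) (h : ∀ x ∈ U, (x, y) ∈ bad) :
    U.image (fun x => (x, y)) ⊆ inner bad U V := by
  intro p hp
  obtain ⟨x, hx, rfl⟩ := Finset.mem_image.1 hp
  exact mem_inner.2 ⟨h x hx, hx, hy⟩

theorem card_image_right : (V.image fun y => (x, y)).card = V.card :=
  Finset.card_image_of_injective _ fun _ _ h => (Prod.mk.inj h).2

theorem card_image_left : (U.image fun x => (x, y)).card = U.card :=
  Finset.card_image_of_injective _ fun _ _ h => (Prod.mk.inj h).1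

/-- If there are fewer inner bad pairs than uncovered vertices on a side, then some pair that is
not bad can be chosen so that covering it removes two inner bad pairs or, when there are none, a
touching bad pair. -/
theorem exists_good_pair (hUV : U.card = V.card) (hlt : (inner bad U V).card < U.card) :
    ∃ x ∈ U, ∃ y ∈ V, (x, y) ∉ bad ∧
      (inner bad (U.erase x) (V.erase y)).card ≤ (inner bad U V).card - 2 ∧
      ((inner bad U V).card = 0 →
        (touching bad (U.erase x) (V.erase y)).card ≤ (touching bad U V).card - 1) := by
  rcases (inner bad U V).eq_empty_or_nonempty with h0 | hne
  · have hgood : ∀ x ∈ U, ∀ y ∈ V, (x, y) ∉ bad := by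
      intro x hx y hy hxy
      have : (x, y) ∈ inner bad U V := mem_inner.2 ⟨hxy, hx, hy⟩
      simp [h0] at this
    have hUne : U.Nonempty := Finset.card_pos.1 (by omega)
    have hVne : V.Nonempty := Finset.card_pos.1 (by omega)
    suffices h : ∃ x ∈ U, ∃ y ∈ V,
        (touching bad (U.erase x) (V.erase y)).card ≤ (touching bad U V).card - 1 by
      obtain ⟨x, hx, y, hy, h⟩ := h
      refine ⟨x, hx, y, hy, hgood x hx y hy, ?_, fun _ => h⟩
      have := Finset.card_le_card
        (inner_erase_subset (bad := bad) (U := U) (V := V) (x := x) (y := y))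
      rw [h0] at this ⊢
      simpa using this
    rcases (touching bad U V).eq_empty_or_nonempty with h1 | ⟨p, hp⟩
    · obtain ⟨x, hx⟩ := hUne
      obtain ⟨y, hy⟩ := hVne
      refine ⟨x, hx, y, hy, ?_⟩
      have := card_touching_erase_le (bad := bad) (U := U) (V := V) (x := x) (y := y)
      rw [h1] at this ⊢
      simpa using this
    · have hp' := mem_touching.1 hp
      have hnot : ¬ (p.1 ∈ U ∧ p.2 ∈ V) := fun h => hgood p.1 h.1 p.2 h.2 hp'.1
      suffices h : ∃ x ∈ U, ∃ y ∈ V, p ∉ touching bad (U.erase x) (V.erase y) by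
        obtain ⟨x, hx, y, hy, h⟩ := h
        refine ⟨x, hx, y, hy, Nat.le_sub_one_of_lt (Finset.card_lt_card ?_)⟩
        refine Finset.ssubset_iff_subset_ne.2 ⟨fun q => ?_, fun he => h (he ▸ hp)⟩
        simp only [mem_touching, Finset.mem_erase]
        tauto
      rcases hp'.2 with h | h
      · obtain ⟨y, hy⟩ := hVne
        refine ⟨p.1, h, y, hy, ?_⟩
        simp only [mem_touching, Finset.mem_erase]
        tauto
      · obtain ⟨x, hx⟩ := hUne
        refine ⟨x, hx, p.2, h, ?_⟩
        simp only [mem_touching, Finset.mem_erase]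
        tauto
  · obtain ⟨x, hx, y, hy, h1, h2⟩ := exists_notMem_card_inner_erase_le hne
      (fun x hx => by
        by_contra! h
        have := Finset.card_le_card (image_right_subset_inner hx h)
        rw [card_image_right] at this
        omega)
      (fun y hy => by
        by_contra! h
        have := Finset.card_le_card (image_left_subset_inner hy h)
        rw [card_image_left] at this
        omega)
    exact ⟨x, hx, y, hy, h1, h2, fun h => absurd h (Finset.card_pos.2 hne).ne'⟩

/-! ### Covering many pairs, greedily or with spare pairs -/

/-- Cover `b` pairs one after the other. -/
theorem PartialMatching.extend_iterate (h : PartialMatching Own bad c U V)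
    (hUV : U.card = V.card) (hlt : (inner bad U V).card < U.card) (b : ℕ) (hb : b < U.card) :
    ∃ U' V', PartialMatching Own bad (c + b) U' V' ∧ U'.card = U.card - b ∧
      U'.card = V'.card ∧ (inner bad U' V').card ≤ (inner bad U V).card - 2 * b ∧
      (touching bad U' V').card ≤ (touching bad U V).card := by
  induction b with
  | zero => exact ⟨U, V, h, by simp, hUV, by simp, le_rfl⟩
  | succ b ih =>
    obtain ⟨U', V', h1, h2, h3, h4, h5⟩ := ih (by omega)
    obtain ⟨x, hx, y, hy, h6, h7, -⟩ := exists_good_pair (bad := bad) h3 (by omega)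
    refine ⟨U'.erase x, V'.erase y, h1.extend hx hy h6, ?_, ?_, by omega,
      card_touching_erase_le.trans h5⟩
    · rw [Finset.card_erase_of_mem hx]; omega
    · rw [Finset.card_erase_of_mem hx, Finset.card_erase_of_mem hy, h3]

/-- Maker's answer in a typical round, to at most `a` new bad pairs. -/
theorem PartialMatching.round (h : PartialMatching Own bad c U V) (hUV : U.card = V.card)
    {a N : ℕ} (ha : 2 ≤ a) (hN : (inner bad U V).card ≤ N + a) (hlt : N + a < U.card) :
    ∃ U' V', PartialMatching Own bad (c + a) U' V' ∧ U'.card = U.card - a ∧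
      U'.card = V'.card ∧ (inner bad U' V').card ≤ N - 1 ∧
      (touching bad U' V').card + (inner bad U' V').card ≤
        (touching bad U V).card - 1 + N := by
  obtain ⟨U', V', h1, h2, h3, h4, h5⟩ := h.extend_iterate hUV (by omega) (a - 1) (by omega)
  obtain ⟨x, hx, y, hy, h6, h7, h8⟩ := exists_good_pair (bad := bad) h3 (by omega)
  have h9 := card_touching_erase_le (bad := bad) (U := U') (V := V') (x := x) (y := y)
  refine ⟨U'.erase x, V'.erase y, (h1.extend hx hy h6).mono (by omega), ?_, ?_, by omega, ?_⟩
  · rw [Finset.card_erase_of_mem hx]; omega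
  · rw [Finset.card_erase_of_mem hx, Finset.card_erase_of_mem hy, h3]
  -- One unit is gained either way: with no inner bad pair left, the last choice removes a touching
  -- one; otherwise all `a` choices bring the inner count to at most `N - a`.
  · rcases Nat.eq_zero_or_pos (inner bad U' V').card with h10 | h10
    · have := h8 h10
      omega
    · have : (inner bad U' V').card ≤ (touching bad U' V').card := by
        refine Finset.card_le_card fun p => ?_
        simp only [mem_inner, mem_touching]
        tauto
      omega

/-- Each greedy step lowers the inner count by two, or to zero, and `U.card` by one, so the strict
inequality persists until `U` is empty. -/
theorem PartialMatching.complete (h : PartialMatching Own bad c U V) (hUV : U.card = V.card)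
    (hlt : (inner bad U V).card < U.card ∨ U = ∅) :
    PartialMatching Own bad (c + U.card) ∅ ∅ := by
  induction hm : U.card generalizing c U V with
  | zero =>
    rw [Finset.card_eq_zero] at hm
    rw [hm, Finset.card_empty, eq_comm, Finset.card_eq_zero] at hUV
    subst hm hUV
    exact h
  | succ m ih =>
    obtain ⟨x, hx, y, hy, h1, h2, -⟩ := exists_good_pair (bad := bad) hUV
      (hlt.resolve_right (by rintro rfl; simp at hm))
    have hlt' := hlt.resolve_right (by rintro rfl; simp at hm)
    have h3 : (U.erase x).card = m := by rw [Finset.card_erase_of_mem hx, hm]; rfl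
    have := ih (h.extend hx hy h1)
      (by rw [Finset.card_erase_of_mem hx, Finset.card_erase_of_mem hy, hUV])
      (by
        rcases Nat.eq_zero_or_pos m with rfl | hm0
        · exact Or.inr (Finset.card_eq_zero.1 h3)
        · left; omega) h3
    exact this.mono (by omega)

/-- With one spare pair, a matching can be completed by at most one exchange. -/
theorem PartialMatching.complete_of_spare_one [Fintype ι] (h : PartialMatching Own bad c U V)
    (hUV : U.card = V.card) (hle : (inner bad U V).card ≤ U.card + 1)
    (hP : (touching bad U V).card + U.card < Fintype.card ι) :
    PartialMatching Own bad (c + U.card + 1) ∅ ∅ := by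
  induction hm : U.card generalizing c U V with
  | zero =>
    rw [← hm]
    exact (h.complete hUV (Or.inr (Finset.card_eq_zero.1 hm))).mono (by omega)
  | succ m ih =>
    by_cases hlt : (inner bad U V).card < U.card
    · exact (h.complete hUV (Or.inl hlt)).mono (by omega)
    have hcard : ∀ x ∈ U, ∀ y ∈ V, (U.erase x).card = m ∧ (U.erase x).card = (V.erase y).card :=
      fun x hx y hy => by
        rw [Finset.card_erase_of_mem hx, Finset.card_erase_of_mem hy]; omega
    have hexch : ∀ x ∈ U, ∀ y ∈ V, ((inner bad (U.erase x) (V.erase y)).card < m ∨ m = 0) →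
        PartialMatching Own bad (c + (m + 1) + 1) ∅ ∅ := by
      intro x hx y hy hxy
      obtain ⟨h1, h2⟩ := hcard x hx y hy
      refine ((h.exchange hx hy hP).complete h2 ?_).mono (by omega)
      rcases hxy with h3 | h3
      · left; omega
      · right; exact Finset.card_eq_zero.1 (by omega)
    have hUne : U.Nonempty := Finset.card_pos.1 (by omega)
    have hVne : V.Nonempty := Finset.card_pos.1 (by omega)
    rcases Nat.eq_zero_or_pos m with hm0 | hm0
    · obtain ⟨x, hx⟩ := hUne
      obtain ⟨y, hy⟩ := hVne
      exact hexch x hx y hy (Or.inr hm0)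
    by_cases hU : ∀ x ∈ U, ∃ y ∈ V, (x, y) ∉ bad
    · by_cases hV : ∀ y ∈ V, ∃ x ∈ U, (x, y) ∉ bad
      · obtain ⟨x, hx, y, hy, h1, h2⟩ := exists_notMem_card_inner_erase_le
          (Finset.card_pos.1 (by omega)) hU hV
        obtain ⟨h3, h4⟩ := hcard x hx y hy
        have h5 := card_touching_erase_le (bad := bad) (U := U) (V := V) (x := x) (y := y)
        exact (ih (h.extend hx hy h1) h4 (by omega) (by omega) h3).mono (by omega)
      -- All pairs at `y` are bad. Exchanging at `y` removes these `U.card` bad pairs and one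
      -- further bad pair, if any; since there were at most `U.card + 1`, none remains.
      · push Not at hV
        obtain ⟨y, hy, hy'⟩ := hV
        have hsub := image_left_subset_inner hy hy'
        have hD : (U.image fun x => (x, y)).card = U.card := card_image_left
        by_cases hq : ∃ q ∈ inner bad U V, q.2 ≠ y
        · obtain ⟨q, hq, hqy⟩ := hq
          have := card_inner_erase_add_le (D := insert q (U.image fun x => (x, y))) (x := q.1)
            (y := y) (Finset.insert_subset hq hsub) (by simp)
          rw [Finset.card_insert_of_notMem (by simp; rintro x - rfl; exact hqy rfl), hD] at this
          exact hexch q.1 (mem_inner.1 hq).2.1 y hy (by omega)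
        · push Not at hq
          obtain ⟨x, hx⟩ := hUne
          have := card_inner_erase_add_le (D := inner bad U V) (x := x)
            (y := y) subset_rfl (fun p hp => Or.inr (hq p hp))
          exact hexch x hx y hy (by omega)
    · push Not at hU
      obtain ⟨x, hx, hx'⟩ := hU
      have hsub := image_right_subset_inner hx hx'
      have hD : (V.image fun y => (x, y)).card = V.card := card_image_right
      by_cases hq : ∃ q ∈ inner bad U V, q.1 ≠ x
      · obtain ⟨q, hq, hqx⟩ := hq
        have := card_inner_erase_add_le (D := insert q (V.image fun y => (x, y))) (x := x)
          (y := q.2) (Finset.insert_subset hq hsub) (by simp)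
        rw [Finset.card_insert_of_notMem (by simp; rintro y - rfl; exact hqx rfl), hD] at this
        exact hexch x hx q.2 (mem_inner.1 hq).2.2 (by omega)
      · push Not at hq
        obtain ⟨y, hy⟩ := hVne
        have := card_inner_erase_add_le (D := inner bad U V) (x := x)
          (y := y) subset_rfl (fun p hp => Or.inl (hq p hp))
        exact hexch x hx y hy (by omega)

/-- With `d + 1` spare pairs, a matching can be completed by at most `d + 1` exchanges. -/
theorem PartialMatching.complete_of_spare [Fintype ι] (h : PartialMatching Own bad c U V)
    (hUV : U.card = V.card) (d : ℕ) (hle : (inner bad U V).card ≤ U.card + (d + 1))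
    (hP : (touching bad U V).card + U.card < Fintype.card ι) :
    PartialMatching Own bad (c + U.card + (d + 1)) ∅ ∅ := by
  induction d generalizing c U V with
  | zero => exact h.complete_of_spare_one hUV hle hP
  | succ d ih =>
    rcases U.eq_empty_or_nonempty with hU | hU
    · exact (h.complete hUV (Or.inr hU)).mono (by omega)
    · have hU' := Finset.card_pos.2 hU
      -- An exchange may cover a bad pair, so two inner bad pairs can always be hit. It costs one
      -- spare pair, and `U.card + (d + 2)` also drops by exactly two.
      obtain ⟨x, hx, y, hy, h1⟩ := exists_card_inner_erase_le (bad := bad) hU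
        (Finset.card_pos.1 (by omega : 0 < V.card))
      have h2 := Finset.card_erase_of_mem hx
      have h3 := Finset.card_erase_of_mem hy
      have h5 := card_touching_erase_le (bad := bad) (U := U) (V := V) (x := x) (y := y)
      exact (ih (h.exchange hx hy hP) (by omega) (by omega) (by omega)).mono (by omega)

end Bipartite

/-! ### The game on an almost complete bipartite graph -/

section BipartiteGame

variable {α ι : Type*} [DecidableEq α]

/-- With no pair left to claim, the bad set is irrelevant; it can be updated after each move of
Breaker. -/
theorem PartialMatching.of_zero {Own : ι × ι → Prop} {bad bad' : Finset (ι × ι)}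
    {U V : Finset ι} (h : PartialMatching Own bad 0 U V) : PartialMatching Own bad' 0 U V := by
  obtain ⟨σ, E, h1, h2, -, h4⟩ := h
  refine ⟨σ, E, h1, h2, ?_, h4⟩
  rw [Nat.le_zero, Finset.card_eq_zero] at h2
  simp [h2]

theorem partialMatching_univ [Fintype ι] {Own : ι × ι → Prop} :
    PartialMatching Own ∅ 0 (Finset.univ : Finset ι) Finset.univ :=
  ⟨1, ∅, by simp, by simp, by simp, by simp⟩

variable [Fintype ι] [DecidableEq ι]

/-- The pairs that are missing from the start or whose edges belong to `B`. -/
def blocked (e : ι × ι → α) (bad₀ : Finset (ι × ι)) (B : Finset α) : Finset (ι × ι) :=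
  bad₀ ∪ Finset.univ.filter fun p => e p ∈ B

variable {X : Finset α} {F : Set (Finset α)} {a : ℕ} {e : ι × ι → α} {bad₀ : Finset (ι × ι)}
  {M B S : Finset α} {U V : Finset ι}

theorem card_filter_blocked_union_le (he : Function.Injective e) (P : ι × ι → Prop)
    [DecidablePred P] :
    ((blocked e bad₀ (B ∪ S)).filter P).card ≤ ((blocked e bad₀ B).filter P).card + S.card := by
  have h1 : (Finset.univ.filter fun p => e p ∈ S).card ≤ S.card :=
    Finset.card_le_card_of_injOn e (by intro p hp; simpa using hp) he.injOn
  refine (Finset.card_le_card ?_).trans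
    ((Finset.card_union_le _ (Finset.univ.filter fun p => e p ∈ S)).trans
      (Nat.add_le_add_left h1 _))
  intro p
  simp only [blocked, Finset.mem_filter, Finset.mem_union, Finset.mem_univ, true_and]
  tauto

theorem card_inner_blocked_union_le (he : Function.Injective e) :
    (inner (blocked e bad₀ (B ∪ S)) U V).card ≤ (inner (blocked e bad₀ B) U V).card + S.card :=
  card_filter_blocked_union_le he _

theorem card_touching_blocked_union_le (he : Function.Injective e) :
    (touching (blocked e bad₀ (B ∪ S)) U V).card ≤
      (touching (blocked e bad₀ B) U V).card + S.card :=
  card_filter_blocked_union_le he _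

theorem IsMove.card_le {S : Finset α} (h : IsMove X M a S) : S.card ≤ a :=
  h.2.trans_le (min_le_left _ _)

/-- Maker can claim the missing edges of a partial matching in one move. -/
theorem PartialMatching.exists_isMove (hX : ∀ p ∉ bad₀, e p ∈ X)
    (h : PartialMatching (fun p => e p ∈ M) (blocked e bad₀ B) a U V) :
    ∃ T, IsMove X (M ∪ B) a T ∧ PartialMatching (fun p => e p ∈ M ∪ T) ∅ 0 U V := by
  obtain ⟨σ, E, h1, h2, h3, h4⟩ := h
  have hE : ∀ p ∈ E, p ∉ bad₀ ∧ e p ∉ B := by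
    intro p hp
    have := Finset.disjoint_left.1 h3 hp
    simpa [blocked] using this
  obtain ⟨T, hT, hT'⟩ := MakerBreaker.exists_isMove (X := X) (M := M) (B := B)
    (T₀ := E.image e) (a := a)
    (by intro z hz; obtain ⟨p, hp, rfl⟩ := Finset.mem_image.1 hz; exact hX p (hE p hp).1)
    (by
      rw [Finset.disjoint_left]
      intro z hz
      obtain ⟨p, hp, rfl⟩ := Finset.mem_image.1 hz
      exact (hE p hp).2)
    (Finset.card_image_le.trans h2)
  refine ⟨T, hT, σ, ∅, h1, by simp, by simp, fun i hi => Or.inl ?_⟩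
  rcases h4 i hi with h | h
  · exact Finset.mem_union_left _ h
  · exact hT' (Finset.mem_image_of_mem e h)

/-- Here `j` full rounds precede a last one with `r` pairs to cover. The bound `j - 1` on inner bad
pairs reaches zero by then. The sum of touching, inner and uncovered counts falls by one per round
along with `j`, leaving room for Breaker's last `a` edges and an exchange when `j = 0`. -/
theorem winsFrom_of_partialMatching (he : Function.Injective e) (hX : ∀ p ∉ bad₀, e p ∈ X)
    (hF : ∀ σ : Equiv.Perm ι, (Finset.univ.image fun i => e (i, σ i)) ⊆ X →
      (Finset.univ.image fun i => e (i, σ i)) ∈ F) (ha : 2 ≤ a)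
    {r j : ℕ} (hr : 1 ≤ r) (hra : r < a)
    (hM : M ⊆ X) (h : PartialMatching (fun p => e p ∈ M) ∅ 0 U V) (hUV : U.card = V.card)
    (hU : U.card = r + a * j) (hin : (inner (blocked e bad₀ B) U V).card ≤ j - 1)
    (htouch : (touching (blocked e bad₀ B) U V).card + (inner (blocked e bad₀ B) U V).card +
      (a + 1) + U.card ≤ Fintype.card ι + j) :
    WinsFrom X F a a (j + 1) M B := by
  induction j generalizing M B U V with
  | zero =>
    intro S hS
    have hS := hS.card_le
    have h1 := card_inner_blocked_union_le (bad₀ := bad₀) (B := B) (S := S) (U := U) (V := V) he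
    have h2 := card_touching_blocked_union_le (bad₀ := bad₀) (B := B) (S := S) (U := U) (V := V) he
    -- Maker's `a` edges exceed the `r` needed by `d + 1`, the number of exchanges she can afford.
    obtain ⟨d, hd⟩ : ∃ d, a = r + (d + 1) := ⟨a - r - 1, by omega⟩
    have h3 := (h.of_zero (bad' := blocked e bad₀ (B ∪ S))).complete_of_spare hUV d
      (by omega) (by omega)
    obtain ⟨T, hT, σ, E, -, hE, -, hσ⟩ := (h3.mono (by omega : _ ≤ a)).exists_isMove hX
    rw [Nat.le_zero, Finset.card_eq_zero] at hE
    subst hE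
    have hsub : (Finset.univ.image fun i => e (i, σ i)) ⊆ M ∪ T := fun z hz => by
      obtain ⟨i, -, rfl⟩ := Finset.mem_image.1 hz
      simpa using hσ i (by simp)
    exact ⟨T, hT, _, hF σ (hsub.trans (Finset.union_subset hM
      (hT.1.trans Finset.sdiff_subset))), hsub⟩
  | succ j ih =>
    intro S hS
    have hS := hS.card_le
    have h1 := card_inner_blocked_union_le (bad₀ := bad₀) (B := B) (S := S) (U := U) (V := V) he
    have h2 := card_touching_blocked_union_le (bad₀ := bad₀) (B := B) (S := S) (U := U) (V := V) he
    rw [Nat.mul_add, Nat.mul_one] at hU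
    have hj : j ≤ a * j := Nat.le_mul_of_pos_left j (by omega)
    obtain ⟨U', V', h3, h4, h5, h6, h7⟩ := (h.of_zero (bad' := blocked e bad₀ (B ∪ S))).round
      hUV (a := a) (N := (inner (blocked e bad₀ B) U V).card) ha (by omega) (by omega)
    obtain ⟨T, hT, h8⟩ := (h3.mono (by omega : _ ≤ a)).exists_isMove hX
    exact ⟨T, hT, ih (Finset.union_subset hM (hT.1.trans Finset.sdiff_subset)) h8 h5
      (by omega) (by omega) (by omega)⟩

/-- Maker quickly wins the perfect matching game on an almost complete balanced bipartite
graph. -/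
theorem makerWinsWithin_bipartite (he : Function.Injective e) (hX : ∀ p ∉ bad₀, e p ∈ X)
    (hF : ∀ σ : Equiv.Perm ι, (Finset.univ.image fun i => e (i, σ i)) ⊆ X →
      (Finset.univ.image fun i => e (i, σ i)) ∈ F) (ha : 2 ≤ a)
    (hn : a * (2 * bad₀.card + 3 * a + 3) ≤ Fintype.card ι) :
    MakerWinsWithin X F a a (Fintype.card ι / a + 1) := by
  apply makerWinsWithin_of_winsFrom
  have hq : 2 * bad₀.card + 3 * a + 3 ≤ Fintype.card ι / a :=
    (Nat.le_div_iff_mul_le (by omega)).2 (by rwa [mul_comm])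
  have hdm := Nat.div_add_mod (Fintype.card ι) a
  have hmod := Nat.mod_lt (Fintype.card ι) (by omega : a > 0)
  set q := Fintype.card ι / a
  have h1 : ∀ U V : Finset ι, (inner (blocked e bad₀ ∅) U V).card ≤ bad₀.card := fun U V =>
    (Finset.card_le_card (Finset.filter_subset _ _)).trans (by simp [blocked])
  have h2 : ∀ U V : Finset ι, (touching (blocked e bad₀ ∅) U V).card ≤ bad₀.card := fun U V =>
    (Finset.card_le_card (Finset.filter_subset _ _)).trans (by simp [blocked])
  rcases Nat.eq_zero_or_pos (Fintype.card ι % a) with h0 | h0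
  -- If `a` divides `n`, Maker covers only `a - 1` pairs in the first round; then `1 + a * j`
  -- remain, so the last round has `r = 1 < a`.
  · obtain ⟨j, hj⟩ : ∃ j, q = j + 1 := ⟨q - 1, by omega⟩
    rw [hj]
    intro S hS
    have hS := hS.card_le
    have h3 := card_inner_blocked_union_le (bad₀ := bad₀) (B := ∅) (S := S)
      (U := Finset.univ) (V := Finset.univ) he
    have h4 := card_touching_blocked_union_le (bad₀ := bad₀) (B := ∅) (S := S)
      (U := Finset.univ) (V := Finset.univ) he
    have h5 := h1 Finset.univ Finset.univ
    have h6 := h2 Finset.univ Finset.univ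
    have h7 : q ≤ a * q := Nat.le_mul_of_pos_left q (by omega)
    have h12 : a * q = a * j + a := by rw [hj]; ring
    obtain ⟨U, V, h8, h9, h10, h11, h13⟩ := (partialMatching_univ
      (Own := fun p => e p ∈ (∅ : Finset α))).of_zero
        (bad' := blocked e bad₀ (∅ ∪ S)) |>.extend_iterate rfl
        (by rw [Finset.card_univ]; omega) (a - 1) (by rw [Finset.card_univ]; omega)
    obtain ⟨T, hT, h14⟩ := (h8.mono (by omega : _ ≤ a)).exists_isMove hX
    rw [Finset.card_univ] at h9
    exact ⟨T, hT, winsFrom_of_partialMatching he hX hF ha (r := 1) le_rfl (by omega)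
      (Finset.union_subset (Finset.empty_subset _) (hT.1.trans Finset.sdiff_subset)) h14 h10
      (by omega) (by omega) (by omega)⟩
  · have h5 := h1 Finset.univ Finset.univ
    have h6 := h2 Finset.univ Finset.univ
    exact winsFrom_of_partialMatching he hX hF ha h0 hmod (Finset.empty_subset _)
      partialMatching_univ rfl
      (by rw [Finset.card_univ]; omega) (by omega) (by rw [Finset.card_univ]; omega)

end BipartiteGame

/-! ### The game on the complete graph -/

section CompleteGame

variable {V : Type*}

/-- The edges in `F` form a perfect matching on the vertex set `U`. -/
def IsMatchingOn (F : Finset (Sym2 V)) (U : Finset V) : Prop :=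
  (∀ e ∈ F, ¬ e.IsDiag) ∧ (∀ e ∈ F, ∀ v ∈ e, v ∈ U) ∧ ∀ v ∈ U, ∃! e, e ∈ F ∧ v ∈ e

theorem isMatchingOn_empty : IsMatchingOn (∅ : Finset (Sym2 V)) ∅ := by
  simp [IsMatchingOn]

theorem IsMatchingOn.mem_perfectMatchingSets [Fintype V] {F : Finset (Sym2 V)}
    {G : SimpleGraph V} (h : IsMatchingOn F Finset.univ) (hG : ∀ e ∈ F, e ∈ G.edgeSet) :
    F ∈ G.perfectMatchingSets := by
  let P : G.Subgraph :=
    { verts := Set.univ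
      Adj := fun u v => s(u, v) ∈ F
      adj_sub := fun {u v} huv => hG _ huv
      edge_vert := fun _ => Set.mem_univ _
      symm := ⟨fun u v huv => by rwa [Sym2.eq_swap]⟩ }
  refine ⟨P, ⟨?_, fun v => Set.mem_univ v⟩, ?_⟩
  · intro v _
    obtain ⟨e, ⟨he, hve⟩, huniq⟩ := h.2.2 v (Finset.mem_univ v)
    obtain ⟨w, rfl⟩ := Sym2.mem_iff_exists.1 hve
    refine ⟨w, he, fun w' hw' => ?_⟩
    have := huniq s(v, w') ⟨hw', Sym2.mem_mk_left _ _⟩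
    exact Sym2.congr_right.1 this
  · ext e
    induction e with
    | _ u v => simp [P]

variable [DecidableEq V]

theorem IsMatchingOn.insert {F : Finset (Sym2 V)} {U : Finset V} {x z : V}
    (h : IsMatchingOn F U) (hx : x ∉ U) (hz : z ∉ U) (hxz : x ≠ z) :
    IsMatchingOn (insert s(x, z) F) (insert x (insert z U)) := by
  obtain ⟨h1, h2, h3⟩ := h
  refine ⟨?_, ?_, ?_⟩
  · intro e he
    rcases Finset.mem_insert.1 he with rfl | he
    · simpa using hxz
    · exact h1 e he
  · intro e he v hv
    rcases Finset.mem_insert.1 he with rfl | he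
    · rw [Sym2.mem_iff] at hv
      rcases hv with rfl | rfl <;> simp
    · simp [h2 e he v hv]
  · intro v hv
    by_cases hvxz : v ∈ s(x, z)
    · refine ⟨s(x, z), ⟨Finset.mem_insert_self _ _, hvxz⟩, ?_⟩
      rintro e ⟨he, hve⟩
      rcases Finset.mem_insert.1 he with rfl | he
      · rfl
      · have := h2 e he v hve
        rw [Sym2.mem_iff] at hvxz
        rcases hvxz with rfl | rfl <;> contradiction
    · have hvU : v ∈ U := by
        rw [Sym2.mem_iff] at hvxz
        simp only [Finset.mem_insert] at hv
        tauto
      obtain ⟨e, ⟨he, hve⟩, huniq⟩ := h3 v hvU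
      refine ⟨e, ⟨Finset.mem_insert_of_mem he, hve⟩, ?_⟩
      rintro e' ⟨he', hve'⟩
      rcases Finset.mem_insert.1 he' with rfl | he'
      · contradiction
      · exact huniq e' ⟨he', hve'⟩

/-- The members of `bad` that lie inside `U`. -/
def innerEdges (bad : Finset (Sym2 V)) (U : Finset V) : Finset (Sym2 V) :=
  bad ∩ U.sym2

variable {bad : Finset (Sym2 V)} {U : Finset V} {x z : V}

theorem mem_innerEdges {e : Sym2 V} : e ∈ innerEdges bad U ↔ e ∈ bad ∧ ∀ v ∈ e, v ∈ U := by
  simp [innerEdges, Finset.mem_sym2_iff]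

theorem card_innerEdges_erase_add_le {D : Finset (Sym2 V)} (hD : D ⊆ innerEdges bad U)
    (h : ∀ e ∈ D, x ∈ e ∨ z ∈ e) :
    (innerEdges bad ((U.erase x).erase z)).card + D.card ≤ (innerEdges bad U).card := by
  rw [← Finset.card_union_of_disjoint]
  · refine Finset.card_le_card (Finset.union_subset (fun e => ?_) hD)
    simp only [mem_innerEdges, Finset.mem_erase]
    exact fun h => ⟨h.1, fun v hv => (h.2 v hv).2.2⟩
  · rw [Finset.disjoint_left]
    intro e he heD
    simp only [mem_innerEdges, Finset.mem_erase] at he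
    rcases h e heD with h | h
    · exact (he.2 x h).2.1 rfl
    · exact (he.2 z h).1 rfl

theorem card_innerEdges_erase_add_two_le {e f : Sym2 V} (he : e ∈ innerEdges bad U)
    (hf : f ∈ innerEdges bad U) (hef : e ≠ f) (h : x ∈ e ∨ z ∈ e) (h' : x ∈ f ∨ z ∈ f) :
    (innerEdges bad ((U.erase x).erase z)).card + 2 ≤ (innerEdges bad U).card := by
  have := card_innerEdges_erase_add_le (bad := bad) (U := U) (D := {e, f}) (x := x) (z := z)
    (by simp [Finset.insert_subset_iff, he, hf]) (by simp [h, h'])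
  rwa [Finset.card_pair hef] at this

/-- An edge that is not bad can be chosen so that covering it removes two inner bad edges. -/
theorem exists_good_edge (hU : 2 ≤ U.card)
    (hlt : (innerEdges bad U).card + 2 ≤ U.card) :
    ∃ x ∈ U, ∃ z ∈ U, x ≠ z ∧ s(x, z) ∉ bad ∧
      (innerEdges bad ((U.erase x).erase z)).card ≤ (innerEdges bad U).card - 2 := by
  -- A vertex with only bad edges inside `U` would give `U.card - 1` inner bad edges, too many.
  have hgood : ∀ x ∈ U, ∃ z ∈ U, x ≠ z ∧ s(x, z) ∉ bad := by
    intro x hx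
    by_contra! hcon
    have h1 : (U.erase x).card ≤ (innerEdges bad U).card := by
      refine Finset.card_le_card_of_injOn (fun z => s(x, z)) ?_ ?_
      · intro z hz
        obtain ⟨h1, h2⟩ := Finset.mem_erase.1 (Finset.mem_coe.1 hz)
        refine Finset.mem_coe.2 (mem_innerEdges.2 ⟨hcon z h2 h1.symm, fun v hv => ?_⟩)
        rcases Sym2.mem_iff.1 hv with rfl | rfl <;> assumption
      · intro z _ z' _ h
        exact Sym2.congr_right.1 h
    rw [Finset.card_erase_of_mem hx] at h1
    omega
  have hdouble : ∀ e ∈ innerEdges bad U, ∀ f ∈ innerEdges bad U, e ≠ f → ∀ x ∈ e, x ∈ f →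
      ∃ x ∈ U, ∃ z ∈ U, x ≠ z ∧ s(x, z) ∉ bad ∧
        (innerEdges bad ((U.erase x).erase z)).card ≤ (innerEdges bad U).card - 2 := by
    intro e he f hf hef x hxe hxf
    have hx := (mem_innerEdges.1 he).2 x hxe
    obtain ⟨z, hz, h1, h2⟩ := hgood x hx
    have := card_innerEdges_erase_add_two_le he hf hef (x := x) (z := z) (by simp [hxe])
      (by simp [hxf])
    exact ⟨x, hx, z, hz, h1, h2, by omega⟩
  rcases (innerEdges bad U).eq_empty_or_nonempty with h0 | ⟨e, he⟩
  · obtain ⟨x, hx⟩ := Finset.card_pos.1 (by omega : 0 < U.card)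
    obtain ⟨z, hz, h1, h2⟩ := hgood x hx
    have := card_innerEdges_erase_add_le (bad := bad) (U := U) (D := ∅) (x := x) (z := z)
      (by simp) (by simp)
    rw [h0] at this
    exact ⟨x, hx, z, hz, h1, h2, by rw [h0]; simpa using this⟩
  · obtain ⟨x, hxe⟩ : ∃ x, x ∈ e := ⟨e.out.1, Sym2.out_fst_mem e⟩
    have hx := (mem_innerEdges.1 he).2 x hxe
    by_cases h : ∃ f ∈ innerEdges bad U, f ≠ e
    · obtain ⟨f, hf, hfe⟩ := h
      by_cases hxf : x ∈ f
      · exact hdouble e he f hf hfe.symm x hxe hxf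
      obtain ⟨y, hyf⟩ : ∃ y, y ∈ f := ⟨f.out.1, Sym2.out_fst_mem f⟩
      have hy := (mem_innerEdges.1 hf).2 y hyf
      by_cases hye : y ∈ e
      · exact hdouble e he f hf hfe.symm y hye hyf
      have hxy : x ≠ y := by rintro rfl; exact hxf hyf
      -- For disjoint `e`, `f`, the edge `s(x, y)` meets both; if it is itself bad, then it shares
      -- `x` with `e`, and the previous case applies.
      by_cases hb : s(x, y) ∈ bad
      · refine hdouble e he s(x, y) (mem_innerEdges.2 ⟨hb, fun v hv => ?_⟩) ?_ x hxe
          (Sym2.mem_mk_left _ _)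
        · rcases Sym2.mem_iff.1 hv with rfl | rfl <;> assumption
        · rintro rfl
          exact hye (Sym2.mem_mk_right _ _)
      · have := card_innerEdges_erase_add_two_le he hf hfe.symm (x := x) (z := y) (by simp [hxe])
          (by simp [hyf])
        exact ⟨x, hx, y, hy, hxy, hb, by omega⟩
    · push Not at h
      obtain ⟨z, hz, h1, h2⟩ := hgood x hx
      have h3 := card_innerEdges_erase_add_le (D := {e}) (x := x) (z := z)
        (Finset.singleton_subset_iff.2 he) (by simp [hxe])
      have h4 : (innerEdges bad U).card ≤ 1 :=
        Finset.card_le_one.2 fun f hf f' hf' => (h f hf).trans (h f' hf').symm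
      rw [Finset.card_singleton] at h3
      exact ⟨x, hx, z, hz, h1, h2, by omega⟩

/-- A matching can be enlarged by `b` edges that are not bad, one after the other. -/
theorem IsMatchingOn.extend_iterate [Fintype V] {F : Finset (Sym2 V)}
    (h : IsMatchingOn F Uᶜ) {m : ℕ} (hU : U.card = 2 * m)
    (hlt : (innerEdges bad U).card + 2 ≤ U.card) (b : ℕ) (hb : b ≤ m) :
    ∃ (U' : Finset V) (E : Finset (Sym2 V)), IsMatchingOn (F ∪ E) U'ᶜ ∧ U'.card = 2 * (m - b) ∧
      E.card ≤ b ∧ Disjoint E bad ∧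
      (innerEdges bad U').card ≤ (innerEdges bad U).card - 2 * b := by
  induction b with
  | zero => exact ⟨U, ∅, by simpa using h, hU, by simp, by simp, by simp⟩
  | succ b ih =>
    obtain ⟨U', E, h1, h2, h3, h4, h5⟩ := ih (by omega)
    obtain ⟨x, hx, z, hz, hxz, h6, h7⟩ :=
      exists_good_edge (bad := bad) (U := U') (by omega) (by omega)
    refine ⟨(U'.erase x).erase z, Insert.insert s(x, z) E, ?_, ?_,
      (Finset.card_insert_le _ _).trans (by omega), ?_, by omega⟩
    · have := h1.insert (x := z) (z := x) (by simpa using hz) (by simpa using hx) hxz.symm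
      rw [Finset.union_insert, Finset.compl_erase, Finset.compl_erase, Sym2.eq_swap]
      exact this
    · rw [Finset.card_erase_of_mem (Finset.mem_erase.2 ⟨hxz.symm, hz⟩),
        Finset.card_erase_of_mem hx]
      omega
    · rw [Finset.disjoint_insert_left]
      exact ⟨h6, h4⟩

theorem winsFrom_top [Fintype V] {G : SimpleGraph V} [DecidableRel G.Adj] (hG : G = ⊤) {a : ℕ}
    (ha : 2 ≤ a) {j : ℕ} {F M B : Finset (Sym2 V)} (hF : IsMatchingOn F Uᶜ) (hFM : F ⊆ M)
    (hU : U.card = 2 * (a * j)) (hin : innerEdges B U = ∅) :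
    WinsFrom G.edgeFinset G.perfectMatchingSets a a j M B := by
  have hmem : ∀ e : Sym2 V, e ∈ G.edgeFinset ↔ ¬ e.IsDiag := by
    intro e
    rw [SimpleGraph.mem_edgeFinset, hG]
    simp
  induction j generalizing U F M B with
  | zero =>
    have hU0 : U = ∅ := Finset.card_eq_zero.1 (by simpa using hU)
    rw [hU0, Finset.compl_empty] at hF
    exact ⟨F, hF.mem_perfectMatchingSets fun e he =>
      SimpleGraph.mem_edgeFinset.1 ((hmem e).2 (hF.1 e he)), hFM⟩
  | succ j ih =>
    intro S hS
    have hS := hS.card_le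
    have h1 : (innerEdges (B ∪ S) U).card ≤ a := by
      refine (Finset.card_le_card fun e he => ?_).trans hS
      obtain ⟨h1, h2⟩ := mem_innerEdges.1 he
      refine (Finset.mem_union.1 h1).resolve_left fun h => ?_
      have : e ∈ innerEdges B U := mem_innerEdges.2 ⟨h, h2⟩
      simp [hin] at this
    have h2 : a * (j + 1) = a * j + a := by ring
    -- The slack `a + 2 ≤ U.card` holds even when `2 * a` vertices are left, because `2 ≤ a`. Since
    -- `a - 2 * a` truncates to zero, no inner edge of Breaker survives.
    obtain ⟨U', E, h3, h4, h5, h6, h7⟩ := hF.extend_iterate (bad := B ∪ S) hU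
      (by omega) a (by omega)
    obtain ⟨T, hT, hT'⟩ := exists_isMove (X := G.edgeFinset) (M := M) (B := B ∪ S) (T₀ := E)
      (a := a) (fun e he => (hmem e).2 (h3.1 e (Finset.mem_union_right _ he))) h6 h5
    refine ⟨T, hT, ih h3 (Finset.union_subset (hFM.trans Finset.subset_union_left) hT') ?_
      (Finset.card_eq_zero.1 (by omega))⟩
    rw [h4, h2, Nat.add_sub_cancel]

end CompleteGame

/-! ### Transfer to the graph `G` -/

/-- The graph of a bijection between the sides of a balanced bipartition is a matching. -/
theorem isMatchingOn_image {V : Type*} [Fintype V] [DecidableEq V] {n : ℕ}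
    (f : Fin n ⊕ Fin n ≃ V) (σ : Equiv.Perm (Fin n)) :
    IsMatchingOn (Finset.univ.image fun i => s(f (.inl i), f (.inr (σ i)))) Finset.univ := by
  refine ⟨?_, by simp, fun v _ => ?_⟩
  · intro e he
    obtain ⟨i, -, rfl⟩ := Finset.mem_image.1 he
    simp
  · obtain ⟨i, rfl⟩ | ⟨i, rfl⟩ : (∃ i, f (.inl i) = v) ∨ ∃ i, f (.inr (σ i)) = v := by
      obtain ⟨w | w, rfl⟩ := f.surjective v
      · exact Or.inl ⟨w, rfl⟩
      · exact Or.inr ⟨σ.symm w, by simp⟩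
    all_goals
      refine ⟨s(f (.inl i), f (.inr (σ i))), ⟨by simp, by simp⟩, ?_⟩
      rintro e ⟨he, hv⟩
      obtain ⟨j, -, rfl⟩ := Finset.mem_image.1 he
      have : i = j := by simpa using hv
      rw [this]

end MakerBreaker

theorem mainTheorem2 (a C : ℕ) (ha : 2 ≤ a) :
    ∃ n₀ : ℕ, ∀ n : ℕ, n₀ ≤ n →
      ∀ (V : Type*) [Fintype V] [DecidableEq V] (G K H : SimpleGraph V) [DecidableRel G.Adj],
        -- `K` is a copy of `K_{n,n}` that spans the vertex set, and `G ⊇ K - H` with `e(H) ≤ C`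
        Nonempty (K ≃g completeBipartiteGraph (Fin n) (Fin n)) →
        H.edgeSet.ncard ≤ C →
        K \ H ≤ G →
          MakerBreaker.MakerWinsWithin G.edgeFinset G.perfectMatchingSets a a
            (⌊(n : ℚ) / (a : ℚ)⌋₊ + 1) ∧
          (G = ⊤ →
            MakerBreaker.MakerWinsWithin G.edgeFinset G.perfectMatchingSets a a
              ⌈(n : ℚ) / (a : ℚ)⌉₊) := by
  classical
  -- The roughly `n / a` rounds gain one unit of potential each, and must outweigh the initial
  -- defect, at most `2 * C` plus a multiple of `a`.
  refine ⟨a * (2 * C + 3 * a + 3), ?_⟩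
  rintro n hn V _ _ G K H _ ⟨φ⟩ hH hKG
  have hfloor : ⌊(n : ℚ) / (a : ℚ)⌋₊ = n / a := Nat.floor_div_eq_div n a
  let f : Fin n ⊕ Fin n ≃ V := φ.symm.toEquiv
  let edge : Fin n × Fin n → Sym2 V := fun p => s(f (.inl p.1), f (.inr p.2))
  have hedge : Function.Injective edge := by
    rintro ⟨i, j⟩ ⟨i', j'⟩ h
    simpa [edge] using h
  have hK : ∀ p, edge p ∈ K.edgeSet := fun p => by
    change K.Adj (φ.symm _) (φ.symm _)
    rw [φ.symm.map_adj_iff]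
    simp
  let bad₀ : Finset (Fin n × Fin n) := Finset.univ.filter fun p => edge p ∈ H.edgeSet
  have hbad₀ : bad₀.card ≤ C := by
    refine le_trans ?_ hH
    rw [← Set.ncard_coe_finset]
    exact Set.ncard_le_ncard_of_injOn edge (fun p hp => by simpa [bad₀] using hp)
      hedge.injOn (Set.toFinite _)
  have hX : ∀ p ∉ bad₀, edge p ∈ G.edgeFinset := by
    intro p hp
    have h1 : edge p ∉ H.edgeSet := by simpa [bad₀] using hp
    rw [SimpleGraph.mem_edgeFinset]
    exact hKG ((SimpleGraph.sdiff_adj _ _ _ _).2 ⟨hK p, h1⟩)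
  have hF : ∀ σ : Equiv.Perm (Fin n), (Finset.univ.image fun i => edge (i, σ i)) ⊆ G.edgeFinset →
      (Finset.univ.image fun i => edge (i, σ i)) ∈ G.perfectMatchingSets := fun σ hσ =>
    (MakerBreaker.isMatchingOn_image f σ).mem_perfectMatchingSets
      fun e he => SimpleGraph.mem_edgeFinset.1 (hσ he)
  have hbip : MakerBreaker.MakerWinsWithin G.edgeFinset G.perfectMatchingSets a a (n / a + 1) := by
    have h := MakerBreaker.makerWinsWithin_bipartite hedge hX hF ha
      (by rw [Fintype.card_fin]; exact le_trans (Nat.mul_le_mul_left _ (by omega)) hn)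
    rwa [Fintype.card_fin] at h
  rw [hfloor]
  refine ⟨hbip, fun hG => ?_⟩
  have ha0 : (a : ℚ) ≠ 0 := by positivity
  -- Only when `a` divides `n` is the ceiling smaller than the floor plus one, so only then is
  -- completeness of `G` used.
  by_cases hdvd : a ∣ n
  · obtain ⟨q, rfl⟩ := hdvd
    have hceil : ⌈((a * q : ℕ) : ℚ) / (a : ℚ)⌉₊ = q := by
      rw [Nat.cast_mul, mul_div_cancel_left₀ _ ha0, Nat.ceil_natCast]
    rw [hceil]
    apply MakerBreaker.makerWinsWithin_of_winsFrom
    refine MakerBreaker.winsFrom_top (U := Finset.univ) (F := ∅) hG ha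
      (by rw [Finset.compl_univ]; exact MakerBreaker.isMatchingOn_empty) (Finset.empty_subset _)
      ?_ (by simp [MakerBreaker.innerEdges])
    rw [Finset.card_univ, ← Fintype.card_congr f, Fintype.card_sum, Fintype.card_fin, two_mul]
  · have hceil : ⌈(n : ℚ) / (a : ℚ)⌉₊ = n / a + 1 := by
      have hapos : (0 : ℚ) < a := by positivity
      have h1 := Nat.div_add_mod n a
      have h2 : 0 < n % a := Nat.pos_of_ne_zero fun h => hdvd (Nat.dvd_of_mod_eq_zero h)
      have h3 := Nat.mod_lt n (by omega : a > 0)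
      rw [Nat.ceil_eq_iff (Nat.succ_ne_zero _), Nat.succ_sub_one, lt_div_iff₀ hapos,
        div_le_iff₀ hapos]
      norm_cast
      constructor <;> nlinarith
    rwa [hceil]
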